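/- Let $k$ be a nonarchimedean local field with absolute value $|\cdot|$, and let $n\ge 3$, $m\ge 2$ be integers. For $g\in \mathsf{GL}_n(k)$ let $\sigma_1(g)\ge\cdots\ge\sigma_n(g)>0$ be its singular values, that is, $\sigma_i(g)=|a_i|$ for any Cartan decomposition $g=u\,\mathrm{diag}(a_1,\dots,a_n)\,v$ with $u,v\in\mathsf{GL}_n(\mathcal O_k)$ and $|a_1|\ge\cdots\ge|a_n|$. Let $\mathsf F_m$ be the free group of rank $m$, with word length $|\gamma|$ with respect to a free basis, and give $\mathrm{Hom}(\mathsf F_m,\mathsf{GL}_n(k))$ the topology of pointwise convergence. A representation $\rho:\mathsf F_m\to\mathsf{GL}_n(k)$ is a quasi-isometric embedding if there are $c,\theta>0$ with $\sigma_1(\rho(\gamma))/\sigma_n(\rho(\gamma))\ge c\,e^{\theta|\gamma|}$ for all $\gamma\in \mathsf F_m$; it is a robust quasi-isometric embedding if it has an open neighbourhood in $\mathrm{Hom}(\mathsf F_m,\mathsf{GL}_n(k))$ consisting only of quasi-isometric embeddings. For $1\le j\le n-1$, it is $j$-Anosov if there are $c,\varepsilon>0$ with $\sigma_j(\rho(\gamma))/\sigma_{j+1}(\rho(\gamma))\ge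 c\,e^{\varepsilon|\gamma|}$ for all $\gamma\in\mathsf F_m$; it is Anosov if it is $j$-Anosov for some $j\in\{1,\dots,n-1\}$. **Theorem.** There is a robust quasi-isometric embedding $\rho:\mathsf F_m\to\mathsf{GL}_n(k)$ which is not a limit of Anosov representations, i.e. does not lie in the closure of the set of Anosov representations in $\mathrm{Hom}(\mathsf F_m,\mathsf{GL}_n(k))$. More precisely, $\rho$ has an open neighbourhood in $\mathrm{Hom}(\mathsf F_m,\mathsf{GL}_n(k))$ that consists only of quasi-isometric embeddings, none of which is $j$-Anosov for any $j\in\{1,\dots,n-1\}$. -/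

import Mathlib

open scoped Matrix

/-- The group `GL(𝒪)`, where `𝒪 = {x : ‖x‖ ≤ 1}`: the invertible matrices `u` such that all
entries of `u` and of `u⁻¹` lie in `𝒪`. -/
def integralGL (ι k : Type*) [Fintype ι] [DecidableEq ι] [NormedField k] [IsUltrametricDist k] :
    Subgroup (GL ι k) where
  carrier := {u | (∀ i j, ‖(u : Matrix ι ι k) i j‖ ≤ 1) ∧
    ∀ i j, ‖((u⁻¹ : GL ι k) : Matrix ι ι k) i j‖ ≤ 1}
  one_mem' := by
    refine ⟨fun i j => ?_, fun i j => ?_⟩ <;>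
    · by_cases h : i = j <;> simp [h]
  mul_mem' := by
    have key : ∀ A B : Matrix ι ι k, (∀ i j, ‖A i j‖ ≤ 1) → (∀ i j, ‖B i j‖ ≤ 1) →
        ∀ i j, ‖(A * B) i j‖ ≤ 1 := by
      intro A B hA hB i j
      rw [Matrix.mul_apply]
      refine IsUltrametricDist.norm_sum_le_of_forall_le_of_nonneg zero_le_one fun l _ => ?_
      rw [norm_mul]
      exact mul_le_one₀ (hA i l) (norm_nonneg _) (hB l j)
    rintro u v ⟨hu, hu'⟩ ⟨hv, hv'⟩
    refine ⟨?_, ?_⟩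
    · simpa using key _ _ hu hv
    · rw [mul_inv_rev]
      simpa using key _ _ hv' hu'
  inv_mem' := by
    rintro u ⟨hu, hu'⟩
    exact ⟨hu', by simpa using hu⟩

/-- `s` is the list of singular values of the matrix `g` over an ultrametric field: it is
nonincreasing, and there is a Cartan decomposition `g = u · diag(a) · v` with
`u, v ∈ GLₙ(𝒪)` and `s i = ‖a i‖`. -/
def IsSingularValues {k : Type*} [NormedField k] [IsUltrametricDist k] {n : ℕ}
    (g : Matrix (Fin n) (Fin n) k) (s : Fin n → ℝ) : Prop :=
  Antitone s ∧ ∃ u ∈ integralGL (Fin n) k, ∃ v ∈ integralGL (Fin n) k, ∃ a : Fin n → k,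
    g = (u : Matrix (Fin n) (Fin n) k) * Matrix.diagonal a * (v : Matrix (Fin n) (Fin n) k) ∧
      ∀ i, s i = ‖a i‖

section Cartan

variable {k : Type*} [NormedField k] [IsUltrametricDist k]

theorem mem_integralGL_of_mul_eq_one {ι : Type*} [Fintype ι] [DecidableEq ι]
    (A B : Matrix ι ι k) (hAB : A * B = 1) (hA : ∀ i j, ‖A i j‖ ≤ 1) (hB : ∀ i j, ‖B i j‖ ≤ 1) :
    ∃ u ∈ integralGL ι k, (u : Matrix ι ι k) = A :=
  ⟨⟨A, B, hAB, mul_eq_one_comm.mp hAB⟩, ⟨hA, hB⟩, rfl⟩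

theorem exists_cartan_reindex {ι κ : Type*} [Fintype ι] [DecidableEq ι] [Fintype κ]
    [DecidableEq κ] (e f : ι ≃ κ) (M : Matrix ι ι k)
    (h : ∃ u ∈ integralGL κ k, ∃ v ∈ integralGL κ k, ∃ a : κ → k,
      M.submatrix e.symm f.symm =
        (u : Matrix κ κ k) * Matrix.diagonal a * (v : Matrix κ κ k)) :
    ∃ u ∈ integralGL ι k, ∃ v ∈ integralGL ι k, ∃ a : ι → k,
      M = (u : Matrix ι ι k) * Matrix.diagonal a * (v : Matrix ι ι k) := by
  obtain ⟨u, hu, v, hv, a, h⟩ := h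
  obtain ⟨u', hu', hu''⟩ := mem_integralGL_of_mul_eq_one
    ((u : Matrix κ κ k).submatrix e e) (((u⁻¹ : GL κ k) : Matrix κ κ k).submatrix e e)
    (by rw [Matrix.submatrix_mul_equiv]; simp) (fun i j => hu.1 _ _) (fun i j => hu.2 _ _)
  obtain ⟨v', hv', hv''⟩ := mem_integralGL_of_mul_eq_one
    ((v : Matrix κ κ k).submatrix e f) (((v⁻¹ : GL κ k) : Matrix κ κ k).submatrix f e)
    (by rw [Matrix.submatrix_mul_equiv]; simp) (fun i j => hv.1 _ _) (fun i j => hv.2 _ _)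
  refine ⟨u', hu', v', hv', a ∘ e, ?_⟩
  have : M = (M.submatrix e.symm f.symm).submatrix e f := by ext; simp
  rw [this, h, hu'', hv'', ← Matrix.submatrix_mul_equiv _ _ _ e,
    ← Matrix.submatrix_mul_equiv _ _ _ e, Matrix.submatrix_diagonal_equiv]

theorem exists_cartan (n : ℕ) (M : Matrix (Fin n) (Fin n) k) :
    ∃ u ∈ integralGL (Fin n) k, ∃ v ∈ integralGL (Fin n) k, ∃ a : Fin n → k,
      M = (u : Matrix (Fin n) (Fin n) k) * Matrix.diagonal a * (v : Matrix (Fin n) (Fin n) k) := by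
  induction n with
  | zero => exact ⟨1, one_mem _, 1, one_mem _, 0, by ext i; exact i.elim0⟩
  | succ n ih =>
    by_cases hM : M = 0
    · exact ⟨1, one_mem _, 1, one_mem _, 0, by simp [hM]⟩
    obtain ⟨⟨i₀, j₀⟩, hmax⟩ :=
      Finite.exists_max (fun p : Fin (n + 1) × Fin (n + 1) => ‖M p.1 p.2‖)
    have hp : M i₀ j₀ ≠ 0 := by
      intro h0
      apply hM
      ext i j
      simpa [h0] using hmax (i, j)
    let e : Fin (n + 1) ≃ Fin n ⊕ Unit :=
      (finSuccEquiv' i₀).trans (Equiv.optionEquivSumPUnit (Fin n))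
    let f : Fin (n + 1) ≃ Fin n ⊕ Unit :=
      (finSuccEquiv' j₀).trans (Equiv.optionEquivSumPUnit (Fin n))
    refine exists_cartan_reindex e f M ?_
    set N := M.submatrix e.symm f.symm with hN
    have hpN : N (Sum.inr ()) (Sum.inr ()) = M i₀ j₀ := by simp [hN, e, f]
    have hmaxN : ∀ i j, ‖N i j‖ ≤ ‖N (Sum.inr ()) (Sum.inr ())‖ := by
      intro i j
      rw [hpN]
      exact hmax (e.symm i, f.symm j)
    have hp0 : N (Sum.inr ()) (Sum.inr ()) ≠ 0 := hpN ▸ hp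
    set p := N (Sum.inr ()) (Sum.inr ()) with hpdef
    have hdiv : ∀ i j, ‖N i j / p‖ ≤ 1 := by
      intro i j
      rw [norm_div]
      exact div_le_one_of_le₀ (hmaxN i j) (norm_nonneg _)
    -- the column and the row of the pivot, divided by the pivot
    let c : Matrix (Fin n) Unit k := Matrix.of fun i _ => N (Sum.inl i) (Sum.inr ()) / p
    let r : Matrix Unit (Fin n) k := Matrix.of fun _ j => N (Sum.inr ()) (Sum.inl j) / p
    let S : Matrix (Fin n) (Fin n) k := Matrix.of fun i j =>
      N (Sum.inl i) (Sum.inl j) - N (Sum.inl i) (Sum.inr ()) / p * N (Sum.inr ()) (Sum.inl j)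
    obtain ⟨u, hu, v, hv, a, hS⟩ := ih S
    have hone : ∀ {ι : Type} [DecidableEq ι] (i j : ι), ‖(1 : Matrix ι ι k) i j‖ ≤ 1 := by
      intro ι _ i j
      by_cases h : i = j <;> simp [Matrix.one_apply, h]
    obtain ⟨L, hL, hL'⟩ := mem_integralGL_of_mul_eq_one
      (Matrix.fromBlocks 1 c 0 1) (Matrix.fromBlocks 1 (-c) 0 1)
      (by simp [Matrix.fromBlocks_multiply])
      (by rintro (i | i) (j | j) <;> simp [hone, c, hdiv, -norm_div])
      (by rintro (i | i) (j | j) <;> simp [hone, c, hdiv, -norm_div])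
    obtain ⟨R, hR, hR'⟩ := mem_integralGL_of_mul_eq_one
      (Matrix.fromBlocks 1 0 r 1) (Matrix.fromBlocks 1 0 (-r) 1)
      (by simp [Matrix.fromBlocks_multiply])
      (by rintro (i | i) (j | j) <;> simp [hone, r, hdiv, -norm_div])
      (by rintro (i | i) (j | j) <;> simp [hone, r, hdiv, -norm_div])
    obtain ⟨U, hU, hU'⟩ := mem_integralGL_of_mul_eq_one
      (Matrix.fromBlocks (u : Matrix (Fin n) (Fin n) k) 0 0 (1 : Matrix Unit Unit k))
      (Matrix.fromBlocks ((u⁻¹ : GL (Fin n) k) : Matrix (Fin n) (Fin n) k) 0 0 1)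
      (by simp [Matrix.fromBlocks_multiply])
      (by rintro (i | i) (j | j) <;> simp [hu.1])
      (by rintro (i | i) (j | j); exacts [hu.2 i j, by simp, by simp, by simp])
    obtain ⟨V, hV, hV'⟩ := mem_integralGL_of_mul_eq_one
      (Matrix.fromBlocks (v : Matrix (Fin n) (Fin n) k) 0 0 (1 : Matrix Unit Unit k))
      (Matrix.fromBlocks ((v⁻¹ : GL (Fin n) k) : Matrix (Fin n) (Fin n) k) 0 0 1)
      (by simp [Matrix.fromBlocks_multiply])
      (by rintro (i | i) (j | j) <;> simp [hv.1])
      (by rintro (i | i) (j | j); exacts [hv.2 i j, by simp, by simp, by simp])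
    refine ⟨L * U, mul_mem hL hU, V * R, mul_mem hV hR, Sum.elim a (fun _ => p), ?_⟩
    have hD : Matrix.diagonal (Sum.elim a (fun _ : Unit => p)) =
        Matrix.fromBlocks (Matrix.diagonal a) 0 0 (Matrix.diagonal fun _ => p) :=
      (Matrix.fromBlocks_diagonal _ _).symm
    have hmul : ((L * U : GL (Fin n ⊕ Unit) k) : Matrix _ _ k) *
        Matrix.diagonal (Sum.elim a (fun _ : Unit => p)) *
        ((V * R : GL (Fin n ⊕ Unit) k) : Matrix _ _ k) =
        Matrix.fromBlocks 1 c 0 1 * Matrix.fromBlocks S 0 0 (Matrix.diagonal fun _ => p) *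
          Matrix.fromBlocks 1 0 r 1 := by
      have hmid : Matrix.fromBlocks S 0 0 (Matrix.diagonal fun _ : Unit => p) =
          (U : Matrix _ _ k) * Matrix.diagonal (Sum.elim a (fun _ : Unit => p)) *
            (V : Matrix _ _ k) := by
        rw [hD, hU', hV', hS]
        simp [Matrix.fromBlocks_multiply, -Matrix.fromBlocks_diagonal]
      rw [hmid, ← hL', ← hR']
      simp only [Units.val_mul, Matrix.mul_assoc]
    rw [hmul, Matrix.fromBlocks_multiply, Matrix.fromBlocks_multiply]
    simp only [Matrix.one_mul, Matrix.mul_one, Matrix.zero_mul, Matrix.mul_zero, add_zero,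
      zero_add]
    ext i j
    rcases i with i | i <;> rcases j with j | j <;>
      simp [Matrix.mul_apply, c, r, S, ← hpdef] <;> field_simp <;> ring

theorem norm_integralGL_mulVec {ι : Type*} [Fintype ι] [DecidableEq ι] {u : GL ι k}
    (hu : u ∈ integralGL ι k) (x : ι → k) : ‖(u : Matrix ι ι k) *ᵥ x‖ = ‖x‖ := by
  have key : ∀ w ∈ integralGL ι k, ∀ y : ι → k, ‖(w : Matrix ι ι k) *ᵥ y‖ ≤ ‖y‖ := by
    intro w hw y
    refine (pi_norm_le_iff_of_nonneg (norm_nonneg _)).2 fun i => ?_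
    refine IsUltrametricDist.norm_sum_le_of_forall_le_of_nonneg (norm_nonneg _) fun l _ => ?_
    rw [norm_mul]
    exact (mul_le_of_le_one_left (norm_nonneg _) (hw.1 i l)).trans (norm_le_pi_norm y l)
  refine le_antisymm (key u hu x) ?_
  simpa using key u⁻¹ (inv_mem hu) ((u : Matrix ι ι k) *ᵥ x)

/-- Every square matrix over an ultrametric field has singular values. -/
theorem exists_isSingularValues {n : ℕ} (g : Matrix (Fin n) (Fin n) k) :
    ∃ s, IsSingularValues g s := by
  obtain ⟨u, hu, v, hv, a, h⟩ := exists_cartan n g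
  let τ : Equiv.Perm (Fin n) := Tuple.sort fun i => -‖a i‖
  have hτ : Monotone ((fun i => -‖a i‖) ∘ τ) := Tuple.monotone_sort _
  obtain ⟨u', hu', hu''⟩ := mem_integralGL_of_mul_eq_one
    ((u : Matrix (Fin n) (Fin n) k).submatrix (Equiv.refl _) τ)
    (((u⁻¹ : GL (Fin n) k) : Matrix (Fin n) (Fin n) k).submatrix τ (Equiv.refl _))
    (by rw [Matrix.submatrix_mul_equiv]; simp) (fun i j => hu.1 _ _) (fun i j => hu.2 _ _)
  obtain ⟨v', hv', hv''⟩ := mem_integralGL_of_mul_eq_one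
    ((v : Matrix (Fin n) (Fin n) k).submatrix τ (Equiv.refl _))
    (((v⁻¹ : GL (Fin n) k) : Matrix (Fin n) (Fin n) k).submatrix (Equiv.refl _) τ)
    (by rw [Matrix.submatrix_mul_equiv]; simp) (fun i j => hv.1 _ _) (fun i j => hv.2 _ _)
  refine ⟨fun i => ‖a (τ i)‖, fun i j hij => by simpa using hτ hij, u', hu', v', hv', a ∘ τ, ?_,
    fun i => rfl⟩
  rw [hu'', hv'', ← Matrix.submatrix_diagonal_equiv a τ, Matrix.submatrix_mul_equiv,
    Matrix.submatrix_mul_equiv, ← h]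
  rfl

/-- The singular values do not depend on the Cartan decomposition. -/
theorem IsSingularValues.unique {n : ℕ} {g : Matrix (Fin n) (Fin n) k} {s t : Fin n → ℝ}
    (hs : IsSingularValues g s) (ht : IsSingularValues g t) : s = t := by
  suffices key : ∀ s t : Fin n → ℝ, IsSingularValues g s → IsSingularValues g t →
      ∀ j, s j ≤ t j from funext fun j => le_antisymm (key s t hs ht j) (key t s ht hs j)
  clear hs ht s t
  rintro s t ⟨hs, u, hu, v, hv, a, hg, ha⟩ ⟨ht, u', hu', v', hv', b, hg', hb⟩ j
  let Φ : (Fin n → k) →ₗ[k] ({i // i ≠ j} → k) := LinearMap.pi fun i =>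
    if j < i then (LinearMap.proj i.1).comp (Matrix.mulVecLin (v : Matrix (Fin n) (Fin n) k))
    else (LinearMap.proj i.1).comp (Matrix.mulVecLin (v' : Matrix (Fin n) (Fin n) k))
  have hlt : Module.finrank k ({i // i ≠ j} → k) < Module.finrank k (Fin n → k) := by
    rw [Module.finrank_fintype_fun_eq_card, Module.finrank_fintype_fun_eq_card]
    exact Fintype.card_subtype_lt (x := j) (by simp)
  obtain ⟨x, hx, hx0⟩ := Submodule.exists_mem_ne_zero_of_ne_bot (Φ.ker_ne_bot_of_finrank_lt hlt)
  have hΦ : ∀ i (h : i ≠ j), Φ x ⟨i, h⟩ = 0 := fun i h => by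
    rw [LinearMap.mem_ker.1 hx]; rfl
  have h1 : ∀ i, j < i → ((v : Matrix (Fin n) (Fin n) k) *ᵥ x) i = 0 := fun i h => by
    simpa [Φ, h] using hΦ i h.ne'
  have h2 : ∀ i, i < j → ((v' : Matrix (Fin n) (Fin n) k) *ᵥ x) i = 0 := fun i h => by
    simpa [Φ, h.not_gt] using hΦ i h.ne
  have e1 : ‖g *ᵥ x‖ = ‖Matrix.diagonal a *ᵥ ((v : Matrix (Fin n) (Fin n) k) *ᵥ x)‖ := by
    rw [hg, ← Matrix.mulVec_mulVec, ← Matrix.mulVec_mulVec, norm_integralGL_mulVec hu]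
  have e2 : ‖g *ᵥ x‖ = ‖Matrix.diagonal b *ᵥ ((v' : Matrix (Fin n) (Fin n) k) *ᵥ x)‖ := by
    rw [hg', ← Matrix.mulVec_mulVec, ← Matrix.mulVec_mulVec, norm_integralGL_mulVec hu']
  have htj : 0 ≤ t j := hb j ▸ norm_nonneg _
  have hxpos : 0 < ‖x‖ := norm_pos_iff.2 hx0
  have up : ‖g *ᵥ x‖ ≤ t j * ‖x‖ := by
    rw [e2]
    refine (pi_norm_le_iff_of_nonneg (by positivity)).2 fun i => ?_
    rw [Matrix.mulVec_diagonal, norm_mul, ← hb, ← norm_integralGL_mulVec hv' x]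
    rcases lt_or_ge i j with h | h
    · rw [h2 i h]
      simpa using mul_nonneg htj (norm_nonneg _)
    · exact mul_le_mul (ht h) (norm_le_pi_norm _ i) (norm_nonneg _) htj
  have lo : s j * ‖x‖ ≤ ‖g *ᵥ x‖ := by
    rw [e1]
    have : Nonempty (Fin n) := ⟨j⟩
    obtain ⟨i, hi⟩ := Finite.exists_max fun i => ‖((v : Matrix (Fin n) (Fin n) k) *ᵥ x) i‖
    have hnorm : ‖x‖ = ‖((v : Matrix (Fin n) (Fin n) k) *ᵥ x) i‖ := by
      rw [← norm_integralGL_mulVec hv x]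
      exact le_antisymm ((pi_norm_le_iff_of_nonneg (norm_nonneg _)).2 hi) (norm_le_pi_norm _ i)
    have hij : i ≤ j := by
      by_contra h
      rw [hnorm, h1 i (not_le.1 h)] at hxpos
      simp at hxpos
    refine le_trans ?_ (norm_le_pi_norm _ i)
    rw [Matrix.mulVec_diagonal, norm_mul, ← ha, hnorm]
    exact mul_le_mul_of_nonneg_right (hs hij) (norm_nonneg _)
  exact le_of_mul_le_mul_right (lo.trans up) hxpos

end Cartan

/-- The `j`-th singular value `σ_j(g)` of `g ∈ GLₙ(k)`, for `1 ≤ j ≤ n` (so `σ_1` is the largest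
and `σ_n` the smallest); the value is `0` for `j` outside this range. -/
noncomputable def singularValue {k : Type*} [NormedField k] [IsUltrametricDist k] {n : ℕ}
    (g : GL (Fin n) k) (j : ℕ) : ℝ :=
  if h : 1 ≤ j ∧ j ≤ n then
    (exists_isSingularValues (g : Matrix (Fin n) (Fin n) k)).choose ⟨j - 1, by omega⟩
  else 0

theorem singularValue_eq {k : Type*} [NormedField k] [IsUltrametricDist k] {n : ℕ}
    (g : GL (Fin n) k) (s : Fin n → ℝ) (hs : IsSingularValues (g : Matrix (Fin n) (Fin n) k) s)
    (i : Fin n) : singularValue g (i + 1) = s i := by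
  have h : 1 ≤ (i : ℕ) + 1 ∧ (i : ℕ) + 1 ≤ n := by omega
  rw [singularValue, dif_pos h, (exists_isSingularValues _).choose_spec.unique hs]
  rfl

/-- The topology of pointwise convergence on the space `Hom(Γ, G)` of representations. -/
instance representationTopology {Γ G : Type*} [Monoid Γ] [Monoid G] [TopologicalSpace G] :
    TopologicalSpace (Γ →* G) :=
  TopologicalSpace.induced (fun ρ γ => ρ γ) Pi.topologicalSpace

/-- `ρ : F_m → GLₙ(k)` is a quasi-isometric embedding: `σ_1(ρ(γ)) / σ_n(ρ(γ))` grows at least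
exponentially in the word length `|γ|`, which is `FreeGroup.norm γ`. -/
def IsQIEmbedding {k : Type*} [NormedField k] [IsUltrametricDist k] {m n : ℕ}
    (ρ : FreeGroup (Fin m) →* GL (Fin n) k) : Prop :=
  ∃ c > 0, ∃ θ > 0, ∀ γ : FreeGroup (Fin m),
    c * Real.exp (θ * γ.norm) ≤ singularValue (ρ γ) 1 / singularValue (ρ γ) n

/-- `ρ` has an open neighbourhood in `Hom(F_m, GLₙ(k))` that consists of quasi-isometric
embeddings. -/
def IsRobustQIEmbedding {k : Type*} [NormedField k] [IsUltrametricDist k] {m n : ℕ}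
    (ρ : FreeGroup (Fin m) →* GL (Fin n) k) : Prop :=
  ∃ U : Set (FreeGroup (Fin m) →* GL (Fin n) k), IsOpen U ∧ ρ ∈ U ∧ ∀ ρ' ∈ U, IsQIEmbedding ρ'

/-- `ρ : F_m → GLₙ(k)` is `j`-Anosov, `1 ≤ j ≤ n - 1`: the `j`-th singular value gap
`σ_j(ρ(γ)) / σ_{j+1}(ρ(γ))` grows at least exponentially in the word length `|γ|`. -/
def IsJAnosov {k : Type*} [NormedField k] [IsUltrametricDist k] {m n : ℕ}
    (j : ℕ) (ρ : FreeGroup (Fin m) →* GL (Fin n) k) : Prop :=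
  1 ≤ j ∧ j < n ∧ ∃ c > 0, ∃ ε > 0, ∀ γ : FreeGroup (Fin m),
    c * Real.exp (ε * γ.norm) ≤ singularValue (ρ γ) j / singularValue (ρ γ) (j + 1)

/-- `ρ` is Anosov: it is `j`-Anosov for some `j`. -/
def IsAnosov {k : Type*} [NormedField k] [IsUltrametricDist k] {m n : ℕ}
    (ρ : FreeGroup (Fin m) →* GL (Fin n) k) : Prop :=
  ∃ j, IsJAnosov j ρ

/-! ### Singular values: determinant and norm bounds. -/

section SingularValues

variable {k : Type*} [NormedField k] [IsUltrametricDist k]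

/-! Each generator is sent to a rank-one perturbation of the identity, scaling a line by a large `x`
and fixing a hyperplane. Its powers have singular values `‖x‖ ^ N, 1, …, 1`, and its inverse powers
`1, …, 1, ‖x‖ ^ (-N)`. The former rule out a gap at every `j ≥ 2`, the latter at every `j ≤ n - 2`;
since `n ≥ 3` no gap grows.

These values survive perturbation. Nearby inverse generators are still nonexpanding, so powers have
all singular values at least `1`; ping-pong keeps the largest at least `‖x‖ ^ N`; and the norm of
the determinant is locally constant over an ultrametric field. The product of the singular values
therefore leaves no room, and the others equal `1` (`NearDilations.singularValue_pow_eq_one` and its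
inverse version).

For the quasi-isometry bound, lines and hyperplanes of distinct generators are in general position.
Along a reduced word, a suitable vector grows by `ε⁻¹` at each positive letter and does not lose
height at a negative one (`attracted_mulVec`). Negative letters of `γ` are positive letters of
`γ⁻¹`, so `σ₁(ρ γ)` and `σ₁(ρ γ⁻¹) = 1 / σₙ(ρ γ)` together account for every letter. Only entrywise
closeness on the generators and their inverses is used, so the bound is robust. -/

theorem norm_det_le_one {ι : Type*} [Fintype ι] [DecidableEq ι] {A : Matrix ι ι k}
    (hA : ∀ i j, ‖A i j‖ ≤ 1) : ‖A.det‖ ≤ 1 := by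
  rw [Matrix.det_apply]
  refine IsUltrametricDist.norm_sum_le_of_forall_le_of_nonneg zero_le_one fun σ _ => ?_
  have h : ‖∏ i, A (σ i) i‖ ≤ 1 := by
    rw [norm_prod]
    exact Finset.prod_le_one (fun _ _ => norm_nonneg _) fun i _ => hA _ _
  rcases Int.units_eq_one_or (Equiv.Perm.sign σ) with h' | h' <;> simpa [h', -norm_prod] using h

theorem norm_det_integralGL {ι : Type*} [Fintype ι] [DecidableEq ι] {u : GL ι k}
    (hu : u ∈ integralGL ι k) : ‖(u : Matrix ι ι k).det‖ = 1 := by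
  have h1 := norm_det_le_one hu.1
  have h2 := norm_det_le_one hu.2
  have h3 : ‖(u : Matrix ι ι k).det‖ * ‖((u⁻¹ : GL ι k) : Matrix ι ι k).det‖ = 1 := by
    rw [← norm_mul, ← Matrix.det_mul, ← Units.val_mul]
    simp
  nlinarith [norm_nonneg (u : Matrix ι ι k).det]

theorem norm_mulVec_le {ι : Type*} [Fintype ι] {A : Matrix ι ι k} {c d : ℝ} (hc : 0 ≤ c)
    (hd : 0 ≤ d) (hA : ∀ i j, ‖A i j‖ ≤ c) {v : ι → k} (hv : ∀ i, ‖v i‖ ≤ d) (i : ι) :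
    ‖(A *ᵥ v) i‖ ≤ c * d := by
  refine IsUltrametricDist.norm_sum_le_of_forall_le_of_nonneg (mul_nonneg hc hd) fun l _ => ?_
  rw [norm_mul]
  exact mul_le_mul (hA i l) (hv l) (norm_nonneg _) hc

namespace IsSingularValues

variable {n : ℕ} {g : Matrix (Fin n) (Fin n) k} {s : Fin n → ℝ}

theorem nonneg (hs : IsSingularValues g s) (i : Fin n) : 0 ≤ s i := by
  obtain ⟨-, u, hu, v, hv, a, -, ha⟩ := hs
  exact ha i ▸ norm_nonneg _

theorem prod_eq (hs : IsSingularValues g s) : ∏ i, s i = ‖g.det‖ := by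
  obtain ⟨-, u, hu, v, hv, a, rfl, ha⟩ := hs
  simp [norm_det_integralGL hu, norm_det_integralGL hv, ha]

theorem norm_mulVec_le (hs : IsSingularValues g s) {c : ℝ} (hc : 0 ≤ c) (h : ∀ i, s i ≤ c)
    (x : Fin n → k) : ‖g *ᵥ x‖ ≤ c * ‖x‖ := by
  obtain ⟨-, u, hu, v, hv, a, rfl, ha⟩ := hs
  rw [← Matrix.mulVec_mulVec, ← Matrix.mulVec_mulVec, norm_integralGL_mulVec hu]
  refine (pi_norm_le_iff_of_nonneg (by positivity)).2 fun i => ?_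
  rw [Matrix.mulVec_diagonal, norm_mul, ← ha, ← norm_integralGL_mulVec hv x]
  exact mul_le_mul (h i) (norm_le_pi_norm _ i) (norm_nonneg _) hc

theorem le_norm_mulVec (hs : IsSingularValues g s) {c : ℝ} (hc : 0 ≤ c) (h : ∀ i, c ≤ s i)
    (x : Fin n → k) : c * ‖x‖ ≤ ‖g *ᵥ x‖ := by
  obtain ⟨-, u, hu, v, hv, a, rfl, ha⟩ := hs
  rw [← Matrix.mulVec_mulVec, ← Matrix.mulVec_mulVec, norm_integralGL_mulVec hu,
    ← norm_integralGL_mulVec hv x]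
  rcases hc.eq_or_lt with rfl | hc
  · simp
  rw [← le_div_iff₀' hc]
  refine (pi_norm_le_iff_of_nonneg (by positivity)).2 fun i => ?_
  rw [le_div_iff₀' hc]
  refine le_trans ?_ (norm_le_pi_norm _ i)
  rw [Matrix.mulVec_diagonal, norm_mul, ← ha]
  exact mul_le_mul_of_nonneg_right (h i) (norm_nonneg _)

theorem exists_norm_mulVec_eq (hs : IsSingularValues g s) (i : Fin n) :
    ∃ x : Fin n → k, ‖x‖ = 1 ∧ ‖g *ᵥ x‖ = s i := by
  obtain ⟨-, u, hu, v, hv, a, rfl, ha⟩ := hs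
  refine ⟨((v⁻¹ : GL (Fin n) k) : Matrix (Fin n) (Fin n) k) *ᵥ Pi.single i 1, ?_, ?_⟩
  · rw [norm_integralGL_mulVec (inv_mem hv), Pi.norm_single, norm_one]
  · rw [Matrix.mulVec_mulVec, Matrix.mul_assoc, ← Units.val_mul, mul_inv_cancel, Units.val_one,
      Matrix.mul_one, ← Matrix.mulVec_mulVec, norm_integralGL_mulVec hu]
    simp [Pi.norm_single, ha]

end IsSingularValues

end SingularValues

/-! ### Ultrametric inequalities. -/

section Ultrametric

theorem norm_mul_le_of_norm_le_one {k : Type*} [NormedField k] {t a : k} {c : ℝ} (ht : ‖t‖ ≤ 1) (ha : ‖a‖ ≤ c) :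
    ‖t * a‖ ≤ c := by
  rw [norm_mul]
  exact (mul_le_of_le_one_left (norm_nonneg _) ht).trans ha

variable {k : Type*} [NormedField k] [IsUltrametricDist k]

theorem norm_sub_eq_left {a b : k} (h : ‖b‖ < ‖a‖) : ‖a - b‖ = ‖a‖ := by
  rw [sub_eq_add_neg, IsUltrametricDist.norm_add_eq_max_of_norm_ne_norm (by simpa using h.ne'),
    norm_neg, max_eq_left h.le]

theorem norm_eq_of_norm_sub_lt {a b : k} (h : ‖a - b‖ < ‖b‖) : ‖a‖ = ‖b‖ := by
  rw [← norm_sub_eq_left (a := b) (b := b - a) (by rwa [norm_sub_rev])]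
  congr 1
  ring

theorem norm_sub_le_of_norm_le {a b : k} {c : ℝ} (ha : ‖a‖ ≤ c) (hb : ‖b‖ ≤ c) : ‖a - b‖ ≤ c := by
  rw [sub_eq_add_neg]
  exact (IsUltrametricDist.norm_add_le_max _ _).trans (max_le ha (by rwa [norm_neg]))

theorem norm_le_of_norm_sub_le {a b : k} {c : ℝ} (h : ‖a - b‖ ≤ c) (hb : ‖b‖ ≤ c) : ‖a‖ ≤ c := by
  have : a = (a - b) - -b := by ring
  rw [this]
  exact norm_sub_le_of_norm_le h (by simpa using hb)

theorem norm_sub_mul_eq_left {a b t : k} (ht : ‖t‖ < 1) (hab : ‖b‖ ≤ ‖a‖) :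
    ‖a - t * b‖ = ‖a‖ := by
  rcases (norm_nonneg a).eq_or_lt with ha | ha
  · have hb : b = 0 := norm_le_zero_iff.1 (hab.trans ha.ge)
    simp [hb]
  · apply norm_sub_eq_left
    rw [norm_mul]
    nlinarith [norm_nonneg b, norm_nonneg t]

/-- As `‖t‖ < 1`, the larger of `a`, `b` has the norm of its coordinate `a - t * b` or `b - t * a`;
the hypothesis forces it to be `a`. This passes from coordinates adapted to a dilation back to
standard ones. -/
theorem norm_eq_of_norm_sub_mul_lt {a b t : k} (ht : ‖t‖ < 1)
    (h : ‖b - t * a‖ < ‖a - t * b‖) : ‖a‖ = ‖a - t * b‖ := by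
  rcases le_total ‖b‖ ‖a‖ with hab | hab
  · exact (norm_sub_mul_eq_left ht hab).symm
  · rw [norm_sub_mul_eq_left ht hab] at h
    refine absurd h (not_lt.2 (norm_sub_le_of_norm_le hab ?_))
    rw [norm_mul]
    exact mul_le_of_le_one_left (norm_nonneg _) ht.le

end Ultrametric

/-! ### Rank-one dilations. -/

section Dilation

variable {ι k : Type*} [Fintype ι] [DecidableEq ι] [NormedField k]

/-- The linear map that scales the vector `e_p + t e_q` by `y` and fixes the kernel of the
linear form `v ↦ v_p - t v_q`. -/
noncomputable def dilation (p q : ι) (t y : k) : Matrix ι ι k :=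
  1 + Matrix.vecMulVec (Pi.single p 1 + Pi.single q t)
    (((y - 1) * (1 - t ^ 2)⁻¹) • (Pi.single p 1 - Pi.single q t))

variable {p q : ι} {t y : k}

theorem dilation_mulVec (v : ι → k) (l : ι) :
    (dilation p q t y *ᵥ v) l = v l + (y - 1) * (1 - t ^ 2)⁻¹ * (v p - t * v q) *
      ((Pi.single p 1 + Pi.single q t : ι → k) l) := by
  rw [dilation, Matrix.add_mulVec, Matrix.one_mulVec, Matrix.vecMulVec_mulVec]
  simp [sub_dotProduct]
  ring

theorem det_dilation (hpq : p ≠ q) (ht : 1 - t ^ 2 ≠ 0) : (dilation p q t y).det = y := by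
  rw [dilation, Matrix.vecMulVec_eq Unit, Matrix.det_one_add_replicateCol_mul_replicateRow]
  simp [dotProduct_add, hpq, hpq.symm]
  field_simp
  ring

theorem dilation_mul_dilation (hpq : p ≠ q) (ht : 1 - t ^ 2 ≠ 0) (z : k) :
    dilation p q t y * dilation p q t z = dilation p q t (y * z) := by
  refine Matrix.ext_of_mulVec_single fun i => funext fun l => ?_
  rw [← Matrix.mulVec_mulVec]
  simp only [dilation_mulVec]
  simp [hpq, hpq.symm]
  field_simp
  ring

/-- `dilation` as an element of the general linear group. -/
noncomputable def dilationGL (hpq : p ≠ q) (ht : 1 - t ^ 2 ≠ 0) (hy : y ≠ 0) : GL ι k where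
  val := dilation p q t y
  inv := dilation p q t y⁻¹
  val_inv := by rw [dilation_mul_dilation hpq ht, mul_inv_cancel₀ hy]; simp [dilation]
  inv_val := by rw [dilation_mul_dilation hpq ht, inv_mul_cancel₀ hy]; simp [dilation]

end Dilation

/-! ### Ping-pong with perturbed dilations. -/

section PingPong

variable {ι k : Type*} [NormedField k] [IsUltrametricDist k]

/-- The region into which a dilation with parameter `t` (for `true`) or its inverse (for `false`)
maps: the vectors close to the line of `e_p + t e_q`, or those whose component in the plane of `e_p`
and `e_q` is dominant and close to the line of `e_q + t e_p`. -/
def Attracted (p q : ι) (ε : ℝ) (t : k) : Bool → (ι → k) → Prop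
  | true, v => ‖v q - t * v p‖ ≤ ε ^ 2 * ‖v p‖ ∧ ∀ l, l ≠ p → l ≠ q → ‖v l‖ ≤ ε ^ 2 * ‖v p‖
  | false, v => ‖v p - t * v q‖ ≤ ε ^ 2 * ‖v q‖ ∧ ∀ l, l ≠ p → l ≠ q → ‖v l‖ ≤ ‖v q‖

/-- The quantity that grows along the orbit of a vector. -/
def height (p q : ι) (ε : ℝ) : Bool → (ι → k) → ℝ
  | true, v => ε * ‖v p‖
  | false, v => ‖v q‖

/-- The factor by which a letter multiplies the height. -/
noncomputable def gain (ε : ℝ) (b : Bool) : ℝ := bif b then ε⁻¹ else 1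

variable {p q : ι} {ε : ℝ} {t s y : k}

theorem norm_one_sub_sq (ht : ‖t‖ < 1) : ‖1 - t ^ 2‖ = 1 := by
  rw [← norm_one (α := k)]
  apply norm_sub_eq_left
  rw [norm_pow, norm_one]
  exact pow_lt_one₀ (norm_nonneg _) ht two_ne_zero

theorem one_sub_sq_ne_zero (ht : ‖t‖ < 1) : 1 - t ^ 2 ≠ 0 := by
  rw [← norm_ne_zero_iff, norm_one_sub_sq ht]
  exact one_ne_zero

/-- `w` is close to the image of `v` under `dilation p q t y`, in coordinates adapted to the
dilation. -/
structure NearDilation (p q : ι) (t y : k) (r : ℝ) (v w : ι → k) : Prop where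
  fst : ‖(w p - t * w q) - y * (v p - t * v q)‖ ≤ r
  snd : ‖(w q - t * w p) - (v q - t * v p)‖ ≤ r
  other : ∀ l, l ≠ p → l ≠ q → ‖w l - v l‖ ≤ r

/-- The linear form of size at least `ε * B` is expanded to at least `ε⁻² * B`, while the error and
the other adapted coordinates stay within `B`. -/
theorem NearDilation.attracted_true {v w : ι → k} {B : ℝ} (ht : ‖t‖ < 1) (hε : 0 < ε) (hε1 : ε < 1)
    (hB : 0 < B) (hv : ∀ l, ‖v l‖ ≤ B) (hA : ε * B ≤ ‖v p - t * v q‖) (hy : 1 ≤ ε ^ 3 * ‖y‖)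
    (h : NearDilation p q t y (ε ^ 3 * B) v w) :
    Attracted p q ε t true w ∧ ‖w p‖ = ‖y‖ * ‖v p - t * v q‖ := by
  have hε3 : ε ^ 3 ≤ 1 := pow_le_one₀ hε.le hε1.le
  have hε2 : ε ^ 2 < 1 := pow_lt_one₀ hε.le hε1 two_ne_zero
  have hrB : ε ^ 3 * B ≤ B := mul_le_of_le_one_left hB.le hε3
  have hBA : B ≤ ε ^ 2 * (‖y‖ * ‖v p - t * v q‖) := by
    calc B ≤ (ε ^ 3 * ‖y‖) * B := le_mul_of_one_le_left hB.le hy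
      _ = ε ^ 2 * (‖y‖ * (ε * B)) := by ring
      _ ≤ _ := by gcongr
  have hBA' : B < ‖y‖ * ‖v p - t * v q‖ := by
    nlinarith
  have h1 : ‖w p - t * w q‖ = ‖y‖ * ‖v p - t * v q‖ := by
    rw [← norm_mul]
    apply norm_eq_of_norm_sub_lt
    rw [norm_mul]
    exact (h.fst.trans hrB).trans_lt hBA'
  have h2 : ‖w q - t * w p‖ ≤ B := by
    refine norm_le_of_norm_sub_le (h.snd.trans hrB) (norm_sub_le_of_norm_le (hv q) ?_)
    exact norm_mul_le_of_norm_le_one ht.le (hv p)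
  have h3 : ‖w p‖ = ‖y‖ * ‖v p - t * v q‖ := by
    rw [← h1]
    apply norm_eq_of_norm_sub_mul_lt ht
    rw [h1]
    exact h2.trans_lt hBA'
  refine ⟨⟨?_, fun l hp hq => ?_⟩, h3⟩
  · rw [h3]; exact h2.trans hBA
  · rw [h3]; exact (norm_le_of_norm_sub_le ((h.other l hp hq).trans hrB) (hv l)).trans hBA

/-- The form `v p - t * v q` is crushed to at most `ε ^ 3 * B`, and `v q - t * v p` is kept. The
coordinates outside the plane are not contracted, so `hz` has to supply their bound. -/
theorem NearDilation.attracted_false {v w : ι → k} {B : ℝ} (ht : ‖t‖ < 1) (hε : 0 < ε)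
    (hε1 : ε < 1) (hB : 0 < B) (hv : ∀ l, ‖v l‖ ≤ B) (hA : ε * B ≤ ‖v q - t * v p‖)
    (hz : ∀ l, l ≠ p → l ≠ q → ‖v l‖ ≤ ‖v q - t * v p‖) (hy : ‖y‖ ≤ ε ^ 3)
    (h : NearDilation p q t y (ε ^ 3 * B) v w) :
    Attracted p q ε t false w ∧ ‖w q‖ = ‖v q - t * v p‖ := by
  have hε2 : ε ^ 2 < 1 := pow_lt_one₀ hε.le hε1 two_ne_zero
  have hrB : ε ^ 3 * B ≤ ε ^ 2 * ‖v q - t * v p‖ := by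
    calc ε ^ 3 * B = ε ^ 2 * (ε * B) := by ring
      _ ≤ _ := by gcongr
  have hpos : 0 < ‖v q - t * v p‖ := (mul_pos hε hB).trans_le hA
  have hlt : ε ^ 2 * ‖v q - t * v p‖ < ‖v q - t * v p‖ := mul_lt_of_lt_one_left hpos hε2
  have h1 : ‖w q - t * w p‖ = ‖v q - t * v p‖ :=
    norm_eq_of_norm_sub_lt ((h.snd.trans hrB).trans_lt hlt)
  have h2 : ‖w p - t * w q‖ ≤ ε ^ 2 * ‖v q - t * v p‖ := by
    refine norm_le_of_norm_sub_le (h.fst.trans hrB) (le_trans ?_ hrB)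
    rw [norm_mul]
    refine mul_le_mul hy (norm_sub_le_of_norm_le (hv p) ?_) (norm_nonneg _) (by positivity)
    exact norm_mul_le_of_norm_le_one ht.le (hv q)
  have h3 : ‖w q‖ = ‖v q - t * v p‖ := by
    rw [← h1]
    apply norm_eq_of_norm_sub_mul_lt ht
    rw [h1]
    exact h2.trans_lt hlt
  refine ⟨⟨?_, fun l hp hq => ?_⟩, h3⟩
  · rw [h3]; exact h2
  · rw [h3]
    exact norm_le_of_norm_sub_le ((h.other l hp hq).trans (hrB.trans hlt.le)) (hz l hp hq)

theorem Attracted.norm_le_true {v : ι → k} (hs : ‖s‖ < 1) (hε : 0 < ε) (hε1 : ε < 1)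
    (h : Attracted p q ε s true v) (l : ι) : ‖v l‖ ≤ ‖v p‖ := by
  have hle : ε ^ 2 * ‖v p‖ ≤ ‖v p‖ :=
    mul_le_of_le_one_left (norm_nonneg _) (pow_le_one₀ hε.le hε1.le)
  by_cases hp : l = p
  · rw [hp]
  by_cases hq : l = q
  · rw [hq]
    refine norm_le_of_norm_sub_le (h.1.trans hle) ?_
    rw [norm_mul]
    exact mul_le_of_le_one_left (norm_nonneg _) hs.le
  · exact (h.2 l hp hq).trans hle

theorem Attracted.norm_le_false {v : ι → k} (hs : ‖s‖ < 1) (hε : 0 < ε) (hε1 : ε < 1)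
    (h : Attracted p q ε s false v) (l : ι) : ‖v l‖ ≤ ‖v q‖ := by
  have hle : ε ^ 2 * ‖v q‖ ≤ ‖v q‖ :=
    mul_le_of_le_one_left (norm_nonneg _) (pow_le_one₀ hε.le hε1.le)
  by_cases hq : l = q
  · rw [hq]
  by_cases hp : l = p
  · rw [hp]
    refine norm_le_of_norm_sub_le (h.1.trans hle) ?_
    rw [norm_mul]
    exact mul_le_of_le_one_left (norm_nonneg _) hs.le
  · exact h.2 l hp hq

/-- Up to `ε ^ 2 * ‖b‖`, `a - t * b` is `(s - t) * b`, whose norm is at least `ε * ‖b‖`. This keeps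
a vector attracted by one generator away from what another generator, taken with opposite sign,
contracts or neglects. -/
theorem mul_norm_le_norm_sub_mul {a b : k} (hε : 0 < ε) (hε1 : ε < 1) (hts : ε ≤ ‖t - s‖)
    (h : ‖a - s * b‖ ≤ ε ^ 2 * ‖b‖) : ε * ‖b‖ ≤ ‖a - t * b‖ := by
  rcases (norm_nonneg b).eq_or_lt with hb | hb
  · simp [← hb]
  have h1 : ‖(a - t * b) - (s - t) * b‖ < ‖(s - t) * b‖ := by
    calc ‖(a - t * b) - (s - t) * b‖ = ‖a - s * b‖ := by congr 1; ring
      _ ≤ ε ^ 2 * ‖b‖ := h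
      _ < ε * ‖b‖ := by gcongr; nlinarith
      _ ≤ ‖(s - t) * b‖ := by rw [norm_mul, norm_sub_rev]; gcongr
  rw [norm_eq_of_norm_sub_lt h1, norm_mul, norm_sub_rev]
  gcongr

variable [DecidableEq ι]

/-- The eigenvectors `e_p + t e_q` and `e_q + t e_p` serve. -/
theorem exists_attracted (hpq : p ≠ q) (ht : ‖t‖ < 1) (hε : 0 < ε) (hε1 : ε < 1) (b : Bool) :
    ∃ v : ι → k, (∀ l, ‖v l‖ ≤ 1) ∧ Attracted p q ε t b v ∧ ε ≤ height p q ε b v := by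
  cases b with
  | true =>
    have hv : Attracted p q ε t true (Pi.single p 1 + Pi.single q t : ι → k) := by
      refine ⟨?_, fun l hp hq => ?_⟩
      · simp [hpq, hpq.symm]; positivity
      · simp [hp, hq]; positivity
    refine ⟨_, fun l => (hv.norm_le_true ht hε hε1 l).trans ?_, hv, ?_⟩ <;> simp [height, hpq]
  | false =>
    have hv : Attracted p q ε t false (Pi.single p t + Pi.single q 1 : ι → k) := by
      refine ⟨?_, fun l hp hq => ?_⟩
      · simp [hpq, hpq.symm]; positivity
      · simp [hp, hq]
    refine ⟨_, fun l => (hv.norm_le_false ht hε hε1 l).trans ?_, hv, ?_⟩ <;>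
      simp [height, hpq.symm, hε1.le]

variable [Fintype ι]

theorem norm_dilation_mulVec_le (hpq : p ≠ q) (ht : ‖t‖ < 1) (hy : ‖y‖ ≤ 1) {v : ι → k} {B : ℝ}
    (hv : ∀ l, ‖v l‖ ≤ B) (l : ι) : ‖(dilation p q t y *ᵥ v) l‖ ≤ B := by
  have hB : 0 ≤ B := (norm_nonneg _).trans (hv p)
  rw [dilation_mulVec]
  refine (IsUltrametricDist.norm_add_le_max _ _).trans (max_le (hv l) ?_)
  have h1 : ‖y - 1‖ ≤ 1 := norm_sub_le_of_norm_le hy norm_one.le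
  have h2 : ‖v p - t * v q‖ ≤ B := by
    refine norm_sub_le_of_norm_le (hv p) ?_
    exact norm_mul_le_of_norm_le_one ht.le (hv q)
  have h3 : ‖(Pi.single p 1 + Pi.single q t : ι → k) l‖ ≤ 1 := by
    by_cases hp : l = p
    · subst hp; simp [hpq]
    · by_cases hq : l = q
      · subst hq; simp [hp, ht.le]
      · simp [hp, hq]
  rw [norm_mul, norm_mul, norm_mul, norm_inv, norm_one_sub_sq ht, inv_one, mul_one]
  calc _ ≤ 1 * B * 1 := by gcongr
    _ = B := by ring

/-- The three relations are exact for the dilation itself, and in an ultrametric field an entrywise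
error `r` costs `r * B` with no dimension factor. -/
theorem nearDilation_mulVec (hpq : p ≠ q) (ht : ‖t‖ < 1) {g : Matrix ι ι k} {r B : ℝ}
    (hr : 0 ≤ r) (hg : ∀ i j, ‖g i j - dilation p q t y i j‖ ≤ r) {v : ι → k}
    (hv : ∀ l, ‖v l‖ ≤ B) : NearDilation p q t y (r * B) v (g *ᵥ v) := by
  have hB : 0 ≤ B := (norm_nonneg _).trans (hv p)
  have key : ∀ l, ‖((g - dilation p q t y) *ᵥ v) l‖ ≤ r * B :=
    norm_mulVec_le hr hB (fun i j => hg i j) hv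
  have key' : ∀ l, ‖t * ((g - dilation p q t y) *ᵥ v) l‖ ≤ r * B := fun l =>
    norm_mul_le_of_norm_le_one ht.le (key l)
  have ht' := one_sub_sq_ne_zero ht
  refine ⟨?_, ?_, fun l hp hq => ?_⟩
  · convert norm_sub_le_of_norm_le (key p) (key' q) using 2
    rw [Matrix.sub_mulVec]
    simp only [Pi.sub_apply, dilation_mulVec]
    simp [hpq, hpq.symm]
    field_simp
    ring
  · convert norm_sub_le_of_norm_le (key q) (key' p) using 2
    rw [Matrix.sub_mulVec]
    simp only [Pi.sub_apply, dilation_mulVec]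
    simp [hpq, hpq.symm]
    ring
  · convert key l using 2
    rw [Matrix.sub_mulVec]
    simp only [Pi.sub_apply, dilation_mulVec]
    simp [hp, hq]

/-- The ping-pong step. A change of sign between consecutive letters costs a factor `ε`. From
positive to negative it is absorbed by the `ε` in `height`; from negative to positive, that `ε` and
the cost leave `ε ^ 2 * ‖x‖ ≥ ε⁻¹`. The condition `hb` excludes only a letter meeting its own
inverse, or parameters that are too close. -/
theorem attracted_mulVec (hpq : p ≠ q) (ht : ‖t‖ < 1) (hs : ‖s‖ < 1) (hε : 0 < ε) (hε1 : ε < 1)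
    {b b' : Bool} (hb : b = b' ∨ ε ≤ ‖t - s‖) {x : k} (hx : 1 ≤ ε ^ 3 * ‖x‖) {g : Matrix ι ι k}
    (hg : ∀ i j, ‖g i j - dilation p q t (bif b then x else x⁻¹) i j‖ ≤ ε ^ 3) {v : ι → k}
    (hv : Attracted p q ε s b' v) (hpos : 0 < height p q ε b' v) :
    Attracted p q ε t b (g *ᵥ v) ∧ gain ε b * height p q ε b' v ≤ height p q ε b (g *ᵥ v) := by
  have hε3 : 0 < ε ^ 3 := by positivity
  have hx0 : 0 < ‖x‖ := by
    by_contra h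
    nlinarith [norm_nonneg x]
  have hxi : ‖x⁻¹‖ ≤ ε ^ 3 := by
    rw [norm_inv, inv_le_iff_one_le_mul₀ hx0]
    exact hx
  have hx1 : ε⁻¹ ≤ ε ^ 2 * ‖x‖ := by
    rw [inv_le_iff_one_le_mul₀ hε]
    linarith
  have hε2 : ε ^ 2 ≤ ε := by nlinarith
  cases b' with
  | true =>
    have hP : 0 < ‖v p‖ := pos_of_mul_pos_right hpos hε.le
    have hle := hv.norm_le_true hs hε hε1
    have hN := nearDilation_mulVec hpq ht hε3.le hg hle
    cases b with
    | true =>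
      have hA := norm_sub_mul_eq_left ht (hle q)
      obtain ⟨h1, h2⟩ := hN.attracted_true ht hε hε1 hP hle
        (by rw [hA]; exact mul_le_of_le_one_left hP.le hε1.le) hx
      refine ⟨h1, ?_⟩
      simp only [gain, height, h2, cond_true, hA]
      have : ε ^ 2 * ‖x‖ ≤ ‖x‖ := mul_le_of_le_one_left hx0.le (by nlinarith)
      calc ε⁻¹ * (ε * ‖v p‖) ≤ ‖x‖ * (ε * ‖v p‖) := by gcongr; exact hx1.trans this
        _ = _ := by ring
    | false =>
      have hA := mul_norm_le_norm_sub_mul hε hε1 (hb.resolve_left (by simp)) hv.1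
      obtain ⟨h1, h2⟩ := hN.attracted_false ht hε hε1 hP hle hA
        (fun l hp hq => ((hv.2 l hp hq).trans (by gcongr)).trans hA) hxi
      refine ⟨h1, ?_⟩
      simpa [gain, height, h2] using hA
  | false =>
    have hQ : 0 < ‖v q‖ := hpos
    have hle := hv.norm_le_false hs hε hε1
    have hN := nearDilation_mulVec hpq ht hε3.le hg hle
    cases b with
    | true =>
      have hA := mul_norm_le_norm_sub_mul hε hε1 (hb.resolve_left (by simp)) hv.1
      obtain ⟨h1, h2⟩ := hN.attracted_true ht hε hε1 hQ hle hA hx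
      refine ⟨h1, ?_⟩
      simp only [gain, height, h2, cond_true]
      calc ε⁻¹ * ‖v q‖ ≤ (ε ^ 2 * ‖x‖) * ‖v q‖ := by gcongr
        _ = ε * (‖x‖ * (ε * ‖v q‖)) := by ring
        _ ≤ _ := by gcongr
    | false =>
      have hA := norm_sub_mul_eq_left ht (hle p)
      obtain ⟨h1, h2⟩ := hN.attracted_false ht hε hε1 hQ hle
        (by rw [hA]; exact mul_le_of_le_one_left hQ.le hε1.le)
        (fun l hp hq => by rw [hA]; exact hle l) hxi
      refine ⟨h1, ?_⟩
      simp [gain, height, h2, hA]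

theorem norm_mulVec_eq_of_attracted (hpq : p ≠ q) (ht : ‖t‖ < 1) (hε : 0 < ε) (hε1 : ε < 1)
    {x : k} (hx : 1 ≤ ε ^ 3 * ‖x‖) {g : Matrix ι ι k}
    (hg : ∀ i j, ‖g i j - dilation p q t x i j‖ ≤ ε ^ 3) {v : ι → k}
    (hv : Attracted p q ε t true v) (hpos : 0 < ‖v p‖) :
    Attracted p q ε t true (g *ᵥ v) ∧ ‖(g *ᵥ v) p‖ = ‖x‖ * ‖v p‖ := by
  have hle := hv.norm_le_true ht hε hε1
  have hA := norm_sub_mul_eq_left ht (hle q)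
  have := (nearDilation_mulVec hpq ht (by positivity) hg hle).attracted_true ht hε hε1 hpos hle
    (by rw [hA]; exact mul_le_of_le_one_left hpos.le hε1.le) hx
  rwa [hA] at this

end PingPong

/-! ### Counting positive letters, and elementary facts. -/

/-- Inversion reverses the reduced word and flips every sign. -/
theorem FreeGroup.countP_toWord_add_countP_toWord_inv {α : Type*} [DecidableEq α]
    (γ : FreeGroup α) :
    γ.toWord.countP (·.2) + γ⁻¹.toWord.countP (·.2) = γ.norm := by
  rw [FreeGroup.toWord_inv, FreeGroup.norm, List.length_eq_countP_add_countP (·.2),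
    FreeGroup.invRev, List.countP_reverse, List.countP_map]
  congr 2
  ext a
  simp

/-- Applied to singular values or their inverses: a determinant no larger than the extreme value
pins down all the rest. -/
theorem eq_one_of_prod_le {ι : Type*} [Fintype ι] {f : ι → ℝ} (hf : ∀ i, 1 ≤ f i) {i₀ : ι}
    (h : ∏ i, f i ≤ f i₀) {i : ι} (hi : i ≠ i₀) : f i = 1 := by
  classical
  refine le_antisymm ?_ (hf i)
  rw [← Finset.mul_prod_erase _ _ (Finset.mem_univ i₀),
    ← Finset.mul_prod_erase _ _ (Finset.mem_erase.2 ⟨hi, Finset.mem_univ i⟩)] at h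
  have h0 : 0 < f i₀ := zero_lt_one.trans_le (hf i₀)
  have h1 : 1 ≤ ∏ l ∈ (Finset.univ.erase i₀).erase i, f l := by
    rw [← Finset.prod_const_one (s := (Finset.univ.erase i₀).erase i)]
    exact Finset.prod_le_prod (fun _ _ => zero_le_one) fun l _ => hf l
  have h2 : f i * ∏ l ∈ (Finset.univ.erase i₀).erase i, f l ≤ 1 := by
    refine le_of_mul_le_mul_left (h.trans (mul_one _).ge) h0
  nlinarith [hf i]

theorem exists_one_lt_mul_exp {c e : ℝ} (hc : 0 < c) (he : 0 < e) :
    ∃ N : ℕ, 1 < c * Real.exp (e * N) := by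
  obtain ⟨N, hN⟩ := exists_nat_gt (c * e)⁻¹
  refine ⟨N, ?_⟩
  rw [inv_lt_iff_one_lt_mul₀' (mul_pos hc he)] at hN
  nlinarith [Real.add_one_le_exp (e * N)]

theorem continuous_representation_apply {k : Type*} [NormedField k] {m n : ℕ}
    (γ : FreeGroup (Fin m)) :
    Continuous fun ρ : FreeGroup (Fin m) →* GL (Fin n) k =>
      (ρ γ : Matrix (Fin n) (Fin n) k) :=
  Units.continuous_val.comp ((continuous_apply γ).comp continuous_induced_dom)

/-! ### Representations close to the dilations. -/

section Representations

variable {k : Type*} [NormedField k] [IsUltrametricDist k] {m n : ℕ}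

/-- Every generator and every inverse of a generator is mapped by `ρ` close to the corresponding
dilation. -/
def NearDilations (p q : Fin n) (ε : ℝ) (x : k) (t : Fin m → k)
    (ρ : FreeGroup (Fin m) →* GL (Fin n) k) : Prop :=
  ∀ i b, ∀ l l', ‖(ρ (FreeGroup.mk [(i, b)]) : Matrix (Fin n) (Fin n) k) l l' -
    dilation p q (t i) (bif b then x else x⁻¹) l l'‖ ≤ ε ^ 3

variable {p q : Fin n} {ε : ℝ} {x : k} {t : Fin m → k} {ρ : FreeGroup (Fin m) →* GL (Fin n) k}

theorem NearDilations.exists_attracted_word (hpq : p ≠ q) (ht : ∀ i, ‖t i‖ < 1) (hε : 0 < ε)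
    (hε1 : ε < 1) (hts : ∀ i j, i ≠ j → ε ≤ ‖t i - t j‖) (hx : 1 ≤ ε ^ 3 * ‖x‖)
    (hρ : NearDilations p q ε x t ρ) (L : List (Fin m × Bool)) (a : Fin m × Bool)
    (hL : FreeGroup.IsReduced (a :: L)) :
    ∃ v : Fin n → k, (∀ l, ‖v l‖ ≤ 1) ∧
      Attracted p q ε (t a.1) a.2
        ((ρ (FreeGroup.mk (a :: L)) : Matrix (Fin n) (Fin n) k) *ᵥ v) ∧
      ε * ε⁻¹ ^ (a :: L).countP (·.2) ≤
        height p q ε a.2 ((ρ (FreeGroup.mk (a :: L)) : Matrix (Fin n) (Fin n) k) *ᵥ v) := by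
  have hgain : ∀ c : Bool, 0 < gain ε c := by
    rintro (_ | _) <;> simp [gain, hε]
  have hcount : ∀ (c : Fin m × Bool) (l : List (Fin m × Bool)),
      ε * ε⁻¹ ^ (c :: l).countP (·.2) = gain ε c.2 * (ε * ε⁻¹ ^ l.countP (·.2)) := by
    rintro ⟨i, _ | _⟩ l
    · simp [gain]
    · simp [gain, pow_succ]
      ring
  induction L generalizing a with
  | nil =>
    -- The rightmost letter acts first, on a vector already in its own region, so no separation is
    -- needed.
    obtain ⟨v, hv, hatt, hh⟩ := exists_attracted hpq (ht a.1) hε hε1 a.2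
    obtain ⟨h1, h2⟩ := attracted_mulVec hpq (ht a.1) (ht a.1) hε hε1 (Or.inl rfl) hx
      (hρ a.1 a.2) hatt (hε.trans_le hh)
    refine ⟨v, hv, h1, le_trans ?_ h2⟩
    rw [hcount]
    exact mul_le_mul_of_nonneg_left (by simpa using hh) (hgain _).le
  | cons b L ih =>
    rw [FreeGroup.isReduced_cons_cons] at hL
    obtain ⟨v, hv, hatt, hh⟩ := ih b hL.2
    have hab : a.2 = b.2 ∨ ε ≤ ‖t a.1 - t b.1‖ := by
      by_cases h : a.1 = b.1
      · exact Or.inl (hL.1 h)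
      · exact Or.inr (hts _ _ h)
    obtain ⟨h1, h2⟩ := attracted_mulVec hpq (ht a.1) (ht b.1) hε hε1 hab hx
      (hρ a.1 a.2) hatt ((mul_pos hε (pow_pos (inv_pos.2 hε) _)).trans_le hh)
    have hmk : (ρ (FreeGroup.mk (a :: b :: L)) : Matrix (Fin n) (Fin n) k) =
        (ρ (FreeGroup.mk [a]) : Matrix (Fin n) (Fin n) k) *
          (ρ (FreeGroup.mk (b :: L)) : Matrix (Fin n) (Fin n) k) := by
      rw [← Units.val_mul, ← map_mul, FreeGroup.mul_mk]
      rfl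
    refine ⟨v, hv, ?_⟩
    rw [hmk, ← Matrix.mulVec_mulVec, hcount]
    exact ⟨h1, (mul_le_mul_of_nonneg_left hh (hgain _).le).trans h2⟩

theorem NearDilations.exists_le_norm_mulVec (hpq : p ≠ q) (ht : ∀ i, ‖t i‖ < 1) (hε : 0 < ε)
    (hε1 : ε < 1) (hts : ∀ i j, i ≠ j → ε ≤ ‖t i - t j‖) (hx : 1 ≤ ε ^ 3 * ‖x‖)
    (hρ : NearDilations p q ε x t ρ) (γ : FreeGroup (Fin m)) :
    ∃ v : Fin n → k, ‖v‖ ≤ 1 ∧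
      ε * ε⁻¹ ^ γ.toWord.countP (·.2) ≤ ‖(ρ γ : Matrix (Fin n) (Fin n) k) *ᵥ v‖ := by
  rcases hL : γ.toWord with _ | ⟨a, L⟩
  · rw [FreeGroup.toWord_eq_nil_iff] at hL
    refine ⟨Pi.single p 1, by simp [Pi.norm_single], ?_⟩
    rw [hL, map_one, Units.val_one, Matrix.one_mulVec, Pi.norm_single, norm_one]
    simpa using hε1.le
  · obtain ⟨v, hv, -, h⟩ := hρ.exists_attracted_word hpq ht hε hε1 hts hx L a
      (hL ▸ FreeGroup.isReduced_toWord)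
    refine ⟨v, (pi_norm_le_iff_of_nonneg zero_le_one).2 hv, h.trans ?_⟩
    rw [← hL, FreeGroup.mk_toWord]
    rcases a with ⟨i, _ | _⟩
    · exact norm_le_pi_norm _ q
    · exact (mul_le_of_le_one_left (norm_nonneg _) hε1.le).trans (norm_le_pi_norm _ p)

theorem norm_mulVec_le_singularValue_one (hn : 1 ≤ n) (g : GL (Fin n) k) (v : Fin n → k) :
    ‖(g : Matrix (Fin n) (Fin n) k) *ᵥ v‖ ≤ singularValue g 1 * ‖v‖ := by
  obtain ⟨s, hs⟩ := exists_isSingularValues (g : Matrix (Fin n) (Fin n) k)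
  rw [singularValue_eq g s hs ⟨0, hn⟩]
  exact hs.norm_mulVec_le (hs.nonneg _) (fun i => hs.1 (Nat.zero_le _)) v

theorem singularValue_last_mul_norm_le (hn : 1 ≤ n) (g : GL (Fin n) k) (v : Fin n → k) :
    singularValue g n * ‖v‖ ≤ ‖(g : Matrix (Fin n) (Fin n) k) *ᵥ v‖ := by
  obtain ⟨s, hs⟩ := exists_isSingularValues (g : Matrix (Fin n) (Fin n) k)
  have h : singularValue g n = s ⟨n - 1, by omega⟩ := by
    rw [← singularValue_eq g s hs]
    congr 1
    simp
    omega
  rw [h]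
  exact hs.le_norm_mulVec (hs.nonneg _) (fun i => hs.1 (Nat.le_sub_one_of_lt i.2)) v

theorem IsSingularValues.pos {g : GL (Fin n) k} {s : Fin n → ℝ}
    (hs : IsSingularValues (g : Matrix (Fin n) (Fin n) k) s) (i : Fin n) : 0 < s i := by
  refine (hs.nonneg i).lt_of_ne' fun h => ?_
  have := hs.prod_eq
  rw [Finset.prod_eq_zero (Finset.mem_univ i) h] at this
  exact (g.isUnit.map Matrix.detMonoidHom).ne_zero (norm_eq_zero.1 this.symm)

theorem singularValue_pos (g : GL (Fin n) k) {j : ℕ} (hj : 1 ≤ j) (hjn : j ≤ n) :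
    0 < singularValue g j := by
  obtain ⟨s, hs⟩ := exists_isSingularValues (g : Matrix (Fin n) (Fin n) k)
  have := singularValue_eq g s hs ⟨j - 1, by omega⟩
  rw [Nat.sub_add_cancel hj] at this
  exact this ▸ hs.pos _

theorem NearDilations.isQIEmbedding (hpq : p ≠ q) (ht : ∀ i, ‖t i‖ < 1) (hε : 0 < ε)
    (hε1 : ε < 1) (hts : ∀ i j, i ≠ j → ε ≤ ‖t i - t j‖) (hx : 1 ≤ ε ^ 3 * ‖x‖)
    (hρ : NearDilations p q ε x t ρ) : IsQIEmbedding ρ := by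
  have hn : 1 ≤ n := p.pos
  -- One factor `ε` comes from `γ` and one from `γ⁻¹`; each letter contributes `ε⁻¹` to exactly one
  -- of the two norms.
  refine ⟨ε * ε, by positivity, Real.log ε⁻¹, Real.log_pos ((one_lt_inv₀ hε).2 hε1), fun γ => ?_⟩
  obtain ⟨v, hv, h1⟩ := hρ.exists_le_norm_mulVec hpq ht hε hε1 hts hx γ
  obtain ⟨w, hw, h2⟩ := hρ.exists_le_norm_mulVec hpq ht hε hε1 hts hx γ⁻¹
  have hpos := singularValue_pos (ρ γ) hn le_rfl
  have h3 := singularValue_last_mul_norm_le hn (ρ γ)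
    ((ρ γ⁻¹ : Matrix (Fin n) (Fin n) k) *ᵥ w)
  rw [Matrix.mulVec_mulVec, ← Units.val_mul, ← map_mul, mul_inv_cancel, map_one, Units.val_one,
    Matrix.one_mulVec] at h3
  have h4 := norm_mulVec_le_singularValue_one hn (ρ γ) v
  have h5 := singularValue_pos (ρ γ) le_rfl hn
  rw [le_div_iff₀ hpos, mul_comm (Real.log _), Real.exp_nat_mul, Real.exp_log (by positivity),
    ← FreeGroup.countP_toWord_add_countP_toWord_inv, pow_add]
  calc _ = (ε * ε⁻¹ ^ γ.toWord.countP (·.2)) *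
        (singularValue (ρ γ) n * (ε * ε⁻¹ ^ γ⁻¹.toWord.countP (·.2))) := by ring
    _ ≤ (singularValue (ρ γ) 1 * 1) * 1 := by
        refine mul_le_mul (h1.trans (h4.trans (mul_le_mul_of_nonneg_left hv h5.le)))
          ((mul_le_mul_of_nonneg_left h2 hpos.le).trans (h3.trans hw)) (by positivity)
          (by positivity)
    _ = _ := by ring

theorem NearDilations.exists_norm_pow_mulVec (hpq : p ≠ q) (ht : ∀ i, ‖t i‖ < 1) (hε : 0 < ε)
    (hε1 : ε < 1) (hx : 1 ≤ ε ^ 3 * ‖x‖) (hρ : NearDilations p q ε x t ρ) (i : Fin m) (N : ℕ) :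
    ∃ v : Fin n → k, ‖v‖ ≤ 1 ∧
      ‖x‖ ^ N ≤ ‖(ρ (FreeGroup.of i ^ N) : Matrix (Fin n) (Fin n) k) *ᵥ v‖ := by
  obtain ⟨v, hv, hatt, hh⟩ := exists_attracted hpq (ht i) hε hε1 true
  have hvp : 1 ≤ ‖v p‖ := le_of_mul_le_mul_left (by simpa [height] using hh) hε
  have key : Attracted p q ε (t i) true
        ((ρ (FreeGroup.of i ^ N) : Matrix (Fin n) (Fin n) k) *ᵥ v) ∧
      ‖((ρ (FreeGroup.of i ^ N) : Matrix (Fin n) (Fin n) k) *ᵥ v) p‖ = ‖x‖ ^ N * ‖v p‖ := by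
    have hx0 : 0 < ‖x‖ := by
      by_contra h
      nlinarith [norm_nonneg x, pow_pos hε 3]
    induction N with
    | zero => simpa using hatt
    | succ N ih =>
      rw [pow_succ', map_mul, Units.val_mul, ← Matrix.mulVec_mulVec]
      have := norm_mulVec_eq_of_attracted hpq (ht i) hε hε1 hx (hρ i true) ih.1
        (ih.2 ▸ by positivity)
      refine ⟨this.1, this.2.trans ?_⟩
      rw [ih.2]
      ring
  refine ⟨v, (pi_norm_le_iff_of_nonneg zero_le_one).2 hv, le_trans ?_ (norm_le_pi_norm _ p)⟩
  rw [key.2]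
  exact le_mul_of_one_le_right (by positivity) hvp

/-- The inverse dilation has integral entries and the perturbation is at most `1`, so the
ultrametric inequality keeps the constant exactly `1` for all `N`. -/
theorem NearDilations.norm_inv_pow_mulVec_le (hpq : p ≠ q) (ht : ∀ i, ‖t i‖ < 1) (hε : 0 < ε)
    (hε1 : ε < 1) (hx : 1 ≤ ε ^ 3 * ‖x‖) (hρ : NearDilations p q ε x t ρ) (i : Fin m) (N : ℕ)
    (v : Fin n → k) :
    ‖(ρ ((FreeGroup.of i)⁻¹ ^ N) : Matrix (Fin n) (Fin n) k) *ᵥ v‖ ≤ ‖v‖ := by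
  have hε3 : ε ^ 3 ≤ 1 := pow_le_one₀ hε.le hε1.le
  have hx1 : ‖x⁻¹‖ ≤ 1 := by
    rw [norm_inv]
    exact inv_le_one_of_one_le₀ (by nlinarith [norm_nonneg x])
  induction N with
  | zero => simp
  | succ N ih =>
    rw [pow_succ', map_mul, Units.val_mul, ← Matrix.mulVec_mulVec]
    set w := (ρ ((FreeGroup.of i)⁻¹ ^ N) : Matrix (Fin n) (Fin n) k) *ᵥ v
    refine le_trans ((pi_norm_le_iff_of_nonneg (norm_nonneg w)).2 fun l => ?_) ih
    have h1 := norm_mulVec_le (pow_nonneg hε.le 3) (norm_nonneg w) (hρ i false)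
      (norm_le_pi_norm w) l
    have h2 := norm_dilation_mulVec_le hpq (ht i) hx1 (norm_le_pi_norm w) l
    refine norm_le_of_norm_sub_le (b := (dilation p q (t i) x⁻¹ *ᵥ w) l) ?_ h2
    refine le_trans (le_of_eq ?_) (h1.trans (mul_le_of_le_one_left (norm_nonneg _) hε3))
    rw [← Pi.sub_apply, ← Matrix.sub_mulVec]
    rfl

/-- All singular values are at least `1` because the inverse power does not expand. Their product is
`‖x‖ ^ N` and the first already reaches that. -/
theorem NearDilations.singularValue_pow_eq_one (hpq : p ≠ q) (ht : ∀ i, ‖t i‖ < 1) (hε : 0 < ε)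
    (hε1 : ε < 1) (hx : 1 ≤ ε ^ 3 * ‖x‖) (hρ : NearDilations p q ε x t ρ) {i : Fin m}
    (hdet : ‖(ρ (FreeGroup.of i) : Matrix (Fin n) (Fin n) k).det‖ = ‖x‖) (N : ℕ) {j : ℕ}
    (hj : 2 ≤ j) (hjn : j ≤ n) : singularValue (ρ (FreeGroup.of i ^ N)) j = 1 := by
  obtain ⟨s, hs⟩ := exists_isSingularValues
    (ρ (FreeGroup.of i ^ N) : Matrix (Fin n) (Fin n) k)
  have h := singularValue_eq _ s hs ⟨j - 1, by omega⟩
  rw [Nat.sub_add_cancel (by omega)] at h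
  rw [h]
  refine eq_one_of_prod_le (i₀ := ⟨0, p.pos⟩) (fun l => ?_) ?_
    (by rw [ne_eq, Fin.mk.injEq]; omega)
  · obtain ⟨y, hy, hy'⟩ := hs.exists_norm_mulVec_eq l
    have := hρ.norm_inv_pow_mulVec_le hpq ht hε hε1 hx i N
      ((ρ (FreeGroup.of i ^ N) : Matrix (Fin n) (Fin n) k) *ᵥ y)
    rwa [hy', Matrix.mulVec_mulVec, ← Units.val_mul, ← map_mul, inv_pow, inv_mul_cancel, map_one,
      Units.val_one, Matrix.one_mulVec, hy] at this
  · obtain ⟨v, hv, hv'⟩ := hρ.exists_norm_pow_mulVec hpq ht hε hε1 hx i N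
    rw [hs.prod_eq, map_pow, Units.val_pow_eq_pow_val, Matrix.det_pow, norm_pow, hdet]
    refine hv'.trans ((hs.norm_mulVec_le (hs.nonneg ⟨0, by omega⟩)
      (fun i => hs.1 (Nat.zero_le _)) v).trans ?_)
    exact mul_le_of_le_one_right (hs.nonneg _) hv

/-- Dual argument: the inverses of the singular values are at least `1`, and the last one exhausts
their product `‖x‖ ^ N`. -/
theorem NearDilations.singularValue_inv_pow_eq_one (hpq : p ≠ q) (ht : ∀ i, ‖t i‖ < 1)
    (hε : 0 < ε) (hε1 : ε < 1) (hx : 1 ≤ ε ^ 3 * ‖x‖) (hρ : NearDilations p q ε x t ρ) {i : Fin m}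
    (hdet : ‖(ρ (FreeGroup.of i) : Matrix (Fin n) (Fin n) k).det‖ = ‖x‖) (N : ℕ) {j : ℕ}
    (hj : 1 ≤ j) (hjn : j < n) : singularValue (ρ ((FreeGroup.of i)⁻¹ ^ N)) j = 1 := by
  obtain ⟨s, hs⟩ := exists_isSingularValues
    (ρ ((FreeGroup.of i)⁻¹ ^ N) : Matrix (Fin n) (Fin n) k)
  have h := singularValue_eq _ s hs ⟨j - 1, by omega⟩
  rw [Nat.sub_add_cancel (by omega)] at h
  rw [h, ← inv_eq_one]
  have hmul : (ρ ((FreeGroup.of i)⁻¹ ^ N) : Matrix (Fin n) (Fin n) k) *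
      (ρ (FreeGroup.of i ^ N) : Matrix (Fin n) (Fin n) k) = 1 := by
    rw [← Units.val_mul, ← map_mul, inv_pow, inv_mul_cancel, map_one, Units.val_one]
  refine eq_one_of_prod_le (f := fun l => (s l)⁻¹) (i₀ := ⟨n - 1, by omega⟩) (fun l => ?_) ?_
    (by rw [ne_eq, Fin.mk.injEq]; omega)
  · obtain ⟨y, hy, hy'⟩ := hs.exists_norm_mulVec_eq l
    have := hρ.norm_inv_pow_mulVec_le hpq ht hε hε1 hx i N y
    exact (one_le_inv₀ (hs.pos l)).2 (by rwa [hy', hy] at this)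
  · obtain ⟨v, hv, hv'⟩ := hρ.exists_norm_pow_mulVec hpq ht hε hε1 hx i N
    have hdet' : (∏ l, s l) * ‖x‖ ^ N = 1 := by
      have := congrArg (fun M => ‖M.det‖) hmul
      simp only [Matrix.det_mul, norm_mul, Matrix.det_one, norm_one] at this
      rwa [hs.prod_eq.symm, map_pow, Units.val_pow_eq_pow_val, Matrix.det_pow, norm_pow,
        hdet] at this
    have h1 := hs.le_norm_mulVec (hs.nonneg ⟨n - 1, by omega⟩)
      (fun i => hs.1 (Nat.le_sub_one_of_lt i.2))
      ((ρ (FreeGroup.of i ^ N) : Matrix (Fin n) (Fin n) k) *ᵥ v)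
    rw [Matrix.mulVec_mulVec, hmul, Matrix.one_mulVec] at h1
    rw [Finset.prod_inv_distrib, inv_eq_of_mul_eq_one_right hdet']
    rw [← one_div, le_div_iff₀' (hs.pos _)]
    exact (mul_le_mul_of_nonneg_left hv' (hs.nonneg _)).trans (h1.trans hv)

theorem NearDilations.not_isJAnosov (hpq : p ≠ q) (ht : ∀ i, ‖t i‖ < 1) (hε : 0 < ε)
    (hε1 : ε < 1) (hx : 1 ≤ ε ^ 3 * ‖x‖) (hρ : NearDilations p q ε x t ρ) {i : Fin m}
    (hdet : ‖(ρ (FreeGroup.of i) : Matrix (Fin n) (Fin n) k).det‖ = ‖x‖) (hn : 3 ≤ n) (j : ℕ) :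
    ¬ IsJAnosov j ρ := by
  rintro ⟨hj, hjn, c, hc, e, he, h⟩
  obtain ⟨N, hN⟩ := exists_one_lt_mul_exp hc he
  refine hN.not_ge ?_
  -- For `j = 1` inverse powers have `σ₁ = σ₂ = 1`, as `2 < n`; for `j ≥ 2` positive powers have
  -- `σ_j = σ_{j+1} = 1`.
  rcases hj.eq_or_lt with rfl | hj
  · have := h ((FreeGroup.of i)⁻¹ ^ N)
    rwa [inv_pow, FreeGroup.norm_inv_eq, FreeGroup.norm_of_pow, ← inv_pow,
      hρ.singularValue_inv_pow_eq_one hpq ht hε hε1 hx hdet N le_rfl hjn,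
      hρ.singularValue_inv_pow_eq_one hpq ht hε hε1 hx hdet N (by omega) (by omega),
      div_one] at this
  · have := h (FreeGroup.of i ^ N)
    rwa [FreeGroup.norm_of_pow,
      hρ.singularValue_pow_eq_one hpq ht hε hε1 hx hdet N hj hjn.le,
      hρ.singularValue_pow_eq_one hpq ht hε hε1 hx hdet N (by omega) hjn, div_one] at this

theorem isOpen_setOf_norm_lt {δ : ℝ} (hx : x ≠ 0) :
    IsOpen {ρ : FreeGroup (Fin m) →* GL (Fin n) k |
      (∀ i b, ∀ l l', ‖(ρ (FreeGroup.mk [(i, b)]) : Matrix (Fin n) (Fin n) k) l l' -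
        dilation p q (t i) (bif b then x else x⁻¹) l l'‖ < δ) ∧
      ∀ i, ‖(ρ (FreeGroup.of i) : Matrix (Fin n) (Fin n) k).det‖ = ‖x‖} := by
  refine IsOpen.inter (s := {ρ | _}) (t := {ρ | _}) ?_ ?_
  · simp only [Set.ofPred_forall]
    refine isOpen_iInter_of_finite fun i => isOpen_iInter_of_finite fun b =>
      isOpen_iInter_of_finite fun l => isOpen_iInter_of_finite fun l' => ?_
    exact isOpen_lt (((continuous_representation_apply _).matrix_elem l l').sub
      continuous_const).norm continuous_const
  · simp only [Set.ofPred_forall]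
    refine isOpen_iInter_of_finite fun i => ?_
    -- Spheres of nonzero radius are open, so fixing the norm of the determinant is an open
    -- condition.
    have := (IsUltrametricDist.isOpen_sphere (0 : k) (norm_ne_zero_iff.2 hx)).preimage
      (continuous_representation_apply (n := n) (FreeGroup.of i)).matrix_det
    simpa [Set.preimage] using this

end Representations

/-! ### Choice of parameters and conclusion. -/

theorem exists_separated {k : Type*} [NontriviallyNormedField k] [IsUltrametricDist k] (m : ℕ) :
    ∃ (ε : ℝ) (t : Fin m → k), 0 < ε ∧ ε < 1 ∧ (∀ i, ‖t i‖ < 1) ∧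
      ∀ i j, i ≠ j → ε ≤ ‖t i - t j‖ := by
  obtain ⟨w, hw0, hw1⟩ := NormedField.exists_norm_lt_one k
  -- Distinct powers of `w` differ by the norm of the larger one, which is at least `‖w‖ ^ m`. The
  -- exponents are shifted so that `‖t i‖ < 1`, and `ε < 1` even if `m = 0`.
  refine ⟨‖w‖ ^ (m + 1), fun i => w ^ ((i : ℕ) + 1), by positivity,
    pow_lt_one₀ hw0.le hw1 (by omega), fun i => ?_, ?_⟩
  · rw [norm_pow]
    exact pow_lt_one₀ hw0.le hw1 (by omega)
  · have key : ∀ i j : Fin m, i < j → ‖w‖ ^ (m + 1) ≤ ‖w ^ ((i : ℕ) + 1) - w ^ ((j : ℕ) + 1)‖ := by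
      intro i j hij
      rw [norm_sub_eq_left, norm_pow]
      · exact pow_le_pow_of_le_one hw0.le hw1.le (by omega)
      · rw [norm_pow, norm_pow]
        exact pow_lt_pow_right_of_lt_one₀ hw0 hw1 (by simpa using hij)
    intro i j hij
    rcases lt_or_gt_of_ne hij with h | h
    · exact key i j h
    · rw [norm_sub_rev]
      exact key j i h

theorem theorem1p1 {k : Type*} [NontriviallyNormedField k] [IsUltrametricDist k]
    [LocallyCompactSpace k] (n m : ℕ) (hn : 3 ≤ n) (hm : 2 ≤ m) :
    ∃ ρ : FreeGroup (Fin m) →* GL (Fin n) k,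
      IsRobustQIEmbedding ρ ∧
      ρ ∉ closure {ρ' : FreeGroup (Fin m) →* GL (Fin n) k | IsAnosov ρ'} ∧
      ∃ U : Set (FreeGroup (Fin m) →* GL (Fin n) k), IsOpen U ∧ ρ ∈ U ∧
        ∀ ρ' ∈ U, IsQIEmbedding ρ' ∧ ∀ j, 1 ≤ j → j ≤ n - 1 → ¬ IsJAnosov j ρ' := by
  obtain ⟨ε, t, hε, hε1, ht, hts⟩ := exists_separated (k := k) m
  -- Of the three factors `ε⁻¹`, one is lost to the angle between generators, one to `height`, and
  -- one remains as growth.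
  obtain ⟨x, hx⟩ := NormedField.exists_lt_norm k (ε ^ 3)⁻¹
  replace hx : 1 ≤ ε ^ 3 * ‖x‖ := ((inv_lt_iff_one_lt_mul₀' (by positivity)).1 hx).le
  have hx0 : x ≠ 0 := by
    rintro rfl
    norm_num at hx
  let p : Fin n := ⟨0, by omega⟩
  let q : Fin n := ⟨1, by omega⟩
  have hpq : p ≠ q := by simp [p, q]
  let ρ : FreeGroup (Fin m) →* GL (Fin n) k :=
    FreeGroup.lift fun i => dilationGL hpq (one_sub_sq_ne_zero (ht i)) hx0
  let U : Set (FreeGroup (Fin m) →* GL (Fin n) k) := {ρ |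
      (∀ i b, ∀ l l', ‖(ρ (FreeGroup.mk [(i, b)]) : Matrix (Fin n) (Fin n) k) l l' -
        dilation p q (t i) (bif b then x else x⁻¹) l l'‖ < ε ^ 3) ∧
      ∀ i, ‖(ρ (FreeGroup.of i) : Matrix (Fin n) (Fin n) k).det‖ = ‖x‖}
  have hU : IsOpen U := isOpen_setOf_norm_lt hx0
  have hρ : ρ ∈ U := by
    refine ⟨fun i b l l' => ?_, fun i => ?_⟩
    · have : (ρ (FreeGroup.mk [(i, b)]) : Matrix (Fin n) (Fin n) k) =
          dilation p q (t i) (bif b then x else x⁻¹) := by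
        cases b
        · simp only [ρ, FreeGroup.lift_mk, List.map_cons, List.map_nil, List.prod_singleton,
            cond_false]
          rfl
        · simp only [ρ, FreeGroup.lift_mk, List.map_cons, List.map_nil, List.prod_singleton,
            cond_true]
          rfl
      rw [this, sub_self, norm_zero]
      positivity
    · have : (ρ (FreeGroup.of i) : Matrix (Fin n) (Fin n) k) = dilation p q (t i) x := by
        simp [ρ]
        rfl
      rw [this, det_dilation hpq (one_sub_sq_ne_zero (ht i))]
  have hnear : ∀ ρ' ∈ U, NearDilations p q ε x t ρ' := fun ρ' h i b l l' => (h.1 i b l l').le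
  have hQI : ∀ ρ' ∈ U, IsQIEmbedding ρ' := fun ρ' h =>
    (hnear ρ' h).isQIEmbedding hpq ht hε hε1 hts hx
  -- The cyclic subgroup of a single generator already rules out every gap.
  have hAn : ∀ ρ' ∈ U, ∀ j, ¬ IsJAnosov j ρ' := fun ρ' h j =>
    (hnear ρ' h).not_isJAnosov hpq ht hε hε1 hx (h.2 ⟨0, by omega⟩) hn j
  refine ⟨ρ, ⟨U, hU, hρ, hQI⟩, fun h => ?_, U, hU, hρ, fun ρ' h => ⟨hQI ρ' h, fun j _ _ =>
    hAn ρ' h j⟩⟩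
  obtain ⟨ρ', h1, j, h2⟩ := mem_closure_iff.1 h U hU hρ
  exact hAn ρ' h1 j h2
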